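/- **Theorem 2.** Consider the following two-player zero-sum game $G$ (a Pursuit-Evasion Game with incomplete information and arbitrary signal spaces). The Maximizer (player $1$) and the Minimizer (player $2$) have nonempty finite action sets $A^1,A^2$ and arbitrary measurable spaces $S^1,S^2$ of signals. Let $H_n=(A^1\times A^2)^n$ and $H=\bigcup_{n\ge 0}H_n$. A daily payoff function $f:H\to[0,\infty)$ and, for every $h\in H$, probability distributions $p_h^1$ on $S^1$ and $p_h^2$ on $S^2$ are given. At each stage $n\ge 0$, starting from the empty history $h_0$, the players choose actions $a^1,a^2$ simultaneously and independently, the history becomes $h_{n+1}=h_n\frown\langle a^1,a^2\rangle$, signals $\langle s^1,s^2\rangle$ are drawn from $p^1_{h_{n+1}}\times p^2_{h_{n+1}}$, and player $i$ observes only $s^i$. A (behavioral) strategy of player $i$ is a measurable map $\sigma^i$ from the private histories $\bigcup_n(A^i\times S^i)^n$ (own actions and own signals) to the probability distributions on $A^i$. A pair $\langle\sigma^1,\sigma^2\rangle$ induces a probability measure $\mu_{\sigma^1,\sigma^2}$ on the infinite histories $(A^1\times A^2)^{\mathbb N}$. The payoff of an infinite history $h$ is $\rho(h)=\sum_{n\ge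 0}f(h_n)$, where $h_n$ is its prefix of length $n$. Put $\mathrm{val}_G(\sigma^1)=\inf_{\sigma^2}E_{\mu_{\sigma^1,\sigma^2}}(\rho)$ and $\mathrm{val}_G(\sigma^2)=\sup_{\sigma^1}E_{\mu_{\sigma^1,\sigma^2}}(\rho)$. The game has a value $\mathrm{val}(G)$ if $\sup_{\sigma^1}\mathrm{val}_G(\sigma^1)=\inf_{\sigma^2}\mathrm{val}_G(\sigma^2)$, the common number being $\mathrm{val}(G)$; a strategy $\sigma^i$ is then $\epsilon$-optimal in $G$ if $|\mathrm{val}_G(\sigma^i)-\mathrm{val}(G)|<\epsilon$. Let $G_n$ be the same game with $f$ replaced by $f_n$, equal to $f$ on histories of length at most $n$ and to $0$ on all others. If $\rho$ is bounded on $(A^1\times A^2)^{\mathbb N}$, then $G$ has a uniform value: $G$ has a value, and for every $\epsilon>0$ there are $N$ and strategies $\sigma^1,\sigma^2$ of the two players such that, for every $n>N$, the game $G_n$ has a value and both $\sigma^1$ and $\sigma^2$ are $\epsilon$-optimal in $G_n$. -/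

import Mathlib

open MeasureTheory ProbabilityTheory
open scoped NNReal ENNReal

noncomputable section

/-- A pursuit-evasion game with incomplete information (a cumulative game with nonnegative daily
payoffs), with action sets `A₁`, `A₂` and measurable signal spaces `S₁`, `S₂`.  Player 1 is the
Maximizer and player 2 the Minimizer.  A history of length `n` is a map `Fin n → A₁ × A₂`. -/
structure PursuitEvasionGame (A₁ A₂ S₁ S₂ : Type*) [MeasurableSpace S₁] [MeasurableSpace S₂] where
  /-- The daily payoff of each finite history. -/
  f : ∀ n : ℕ, (Fin n → A₁ × A₂) → ℝ≥0
  /-- The distribution of player 1's signal, for each finite history. -/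
  p₁ : ∀ n : ℕ, (Fin n → A₁ × A₂) → ProbabilityMeasure S₁
  /-- The distribution of player 2's signal, for each finite history. -/
  p₂ : ∀ n : ℕ, (Fin n → A₁ × A₂) → ProbabilityMeasure S₂

/-- A behavioral strategy of a player with actions `A` and signals `S`: a (measurable) map from
the private histories, i.e. the sequences of pairs (own action, own signal), to the probability
distributions on `A`. -/
structure BehavioralStrategy (A S : Type*) [MeasurableSpace A] [MeasurableSpace S] where
  /-- The mixed action used after each private history of length `n`. -/
  act : ∀ n : ℕ, Kernel (Fin n → A × S) A
  isMarkov : ∀ n : ℕ, IsMarkovKernel (act n)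

attribute [instance] BehavioralStrategy.isMarkov

namespace PursuitEvasionGame

/-- What happens at one stage: the pair of actions and the pair of signals. -/
abbrev Stage (A₁ A₂ S₁ S₂ : Type*) : Type _ := (A₁ × A₂) × (S₁ × S₂)

/-- The public history contained in a finite sequence of stages. -/
def hist {A₁ A₂ S₁ S₂ : Type*} {n : ℕ} (z : Fin n → Stage A₁ A₂ S₁ S₂) : Fin n → A₁ × A₂ :=
  fun i => (z i).1

/-- The private history of player 1. -/
def priv₁ {A₁ A₂ S₁ S₂ : Type*} {n : ℕ} (z : Fin n → Stage A₁ A₂ S₁ S₂) : Fin n → A₁ × S₁ :=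
  fun i => ((z i).1.1, (z i).2.1)

/-- The private history of player 2. -/
def priv₂ {A₁ A₂ S₁ S₂ : Type*} {n : ℕ} (z : Fin n → Stage A₁ A₂ S₁ S₂) : Fin n → A₂ × S₂ :=
  fun i => ((z i).1.2, (z i).2.2)

section measurability

variable {A₁ A₂ S₁ S₂ : Type*} [MeasurableSpace A₁] [MeasurableSpace A₂]
  [MeasurableSpace S₁] [MeasurableSpace S₂]

lemma measurable_priv₁ (n : ℕ) :
    Measurable (priv₁ : (Fin n → Stage A₁ A₂ S₁ S₂) → Fin n → A₁ × S₁) := by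
  unfold priv₁; fun_prop

lemma measurable_priv₂ (n : ℕ) :
    Measurable (priv₂ : (Fin n → Stage A₁ A₂ S₁ S₂) → Fin n → A₂ × S₂) := by
  unfold priv₂; fun_prop

/-- The public history after appending the pair of actions just chosen. -/
def nextHist (n : ℕ) (x : (Fin n → Stage A₁ A₂ S₁ S₂) × (A₁ × A₂)) : Fin (n + 1) → A₁ × A₂ :=
  Fin.snoc (hist x.1) x.2

lemma measurable_nextHist (n : ℕ) :
    Measurable (nextHist n :
      (Fin n → Stage A₁ A₂ S₁ S₂) × (A₁ × A₂) → Fin (n + 1) → A₁ × A₂) := by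
  refine measurable_pi_lambda _ fun i => ?_
  refine Fin.lastCases ?_ (fun j => ?_) i
  · simp only [nextHist, Fin.snoc_last]; fun_prop
  · simp only [nextHist, Fin.snoc_castSucc, hist]; fun_prop

end measurability

section play

variable {A₁ A₂ S₁ S₂ : Type*}
  [MeasurableSpace A₁] [DiscreteMeasurableSpace A₁] [Finite A₁]
  [MeasurableSpace A₂] [DiscreteMeasurableSpace A₂] [Finite A₂]
  [MeasurableSpace S₁] [MeasurableSpace S₂]

/-- The law of the signal pair drawn at the history `h`: the product of the two players' signal
distributions. -/
def signalKernel (G : PursuitEvasionGame A₁ A₂ S₁ S₂) (n : ℕ) :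
    Kernel (Fin n → A₁ × A₂) (S₁ × S₂) :=
  Kernel.ofFunOfCountable fun h => (G.p₁ n h : Measure S₁).prod (G.p₂ n h : Measure S₂)

instance (G : PursuitEvasionGame A₁ A₂ S₁ S₂) (n : ℕ) : IsMarkovKernel (G.signalKernel n) :=
  ⟨fun h => by
    change IsProbabilityMeasure ((G.p₁ n h : Measure S₁).prod (G.p₂ n h : Measure S₂))
    infer_instance⟩

/-- The law of the pair of actions at stage `n`: given the past, the players choose independently,
each according to its strategy at its own private history. -/
def actionKernel (σ₁ : BehavioralStrategy A₁ S₁) (σ₂ : BehavioralStrategy A₂ S₂) (n : ℕ) :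
    Kernel (Fin n → Stage A₁ A₂ S₁ S₂) (A₁ × A₂) :=
  ((σ₁.act n).comap priv₁ (measurable_priv₁ n)) ×ₖ ((σ₂.act n).comap priv₂ (measurable_priv₂ n))

instance (σ₁ : BehavioralStrategy A₁ S₁) (σ₂ : BehavioralStrategy A₂ S₂) (n : ℕ) :
    IsMarkovKernel (actionKernel σ₁ σ₂ n) := by
  unfold actionKernel; infer_instance

/-- The law of stage `n` given the past: actions are chosen, the history is extended by them, and
a signal pair is drawn from the distributions attached to the new history. -/
def stageKernel (G : PursuitEvasionGame A₁ A₂ S₁ S₂)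
    (σ₁ : BehavioralStrategy A₁ S₁) (σ₂ : BehavioralStrategy A₂ S₂) (n : ℕ) :
    Kernel (Fin n → Stage A₁ A₂ S₁ S₂) (Stage A₁ A₂ S₁ S₂) :=
  actionKernel σ₁ σ₂ n ⊗ₖ (G.signalKernel (n + 1)).comap (nextHist n) (measurable_nextHist n)

instance (G : PursuitEvasionGame A₁ A₂ S₁ S₂)
    (σ₁ : BehavioralStrategy A₁ S₁) (σ₂ : BehavioralStrategy A₂ S₂) (n : ℕ) :
    IsMarkovKernel (G.stageKernel σ₁ σ₂ n) := by
  unfold stageKernel; infer_instance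

/-- The law of stage `n + 1` given stages `0, …, n`, as a kernel on functions on `Finset.Iic n`. -/
def stepKernel (G : PursuitEvasionGame A₁ A₂ S₁ S₂)
    (σ₁ : BehavioralStrategy A₁ S₁) (σ₂ : BehavioralStrategy A₂ S₂) (n : ℕ) :
    Kernel (Finset.Iic n → Stage A₁ A₂ S₁ S₂) (Stage A₁ A₂ S₁ S₂) :=
  (G.stageKernel σ₁ σ₂ (n + 1)).comap
    (fun x (i : Fin (n + 1)) => x ⟨(i : ℕ), Finset.mem_Iic.2 (Nat.le_of_lt_succ i.isLt)⟩)
    (measurable_pi_lambda _ fun _ => measurable_pi_apply _)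

instance (G : PursuitEvasionGame A₁ A₂ S₁ S₂)
    (σ₁ : BehavioralStrategy A₁ S₁) (σ₂ : BehavioralStrategy A₂ S₂) (n : ℕ) :
    IsMarkovKernel (G.stepKernel σ₁ σ₂ n) := by
  unfold stepKernel; infer_instance

/-- The law of the infinite sequence of stages under a profile. -/
def playMeasure (G : PursuitEvasionGame A₁ A₂ S₁ S₂)
    (σ₁ : BehavioralStrategy A₁ S₁) (σ₂ : BehavioralStrategy A₂ S₂) :
    Measure (ℕ → Stage A₁ A₂ S₁ S₂) :=
  Kernel.trajMeasure (X := fun _ => Stage A₁ A₂ S₁ S₂)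
    (G.stageKernel σ₁ σ₂ 0 Fin.elim0) (G.stepKernel σ₁ σ₂)

/-- The law of the infinite history of actions under a profile. -/
def historyMeasure (G : PursuitEvasionGame A₁ A₂ S₁ S₂)
    (σ₁ : BehavioralStrategy A₁ S₁) (σ₂ : BehavioralStrategy A₂ S₂) :
    Measure (ℕ → A₁ × A₂) :=
  (G.playMeasure σ₁ σ₂).map fun z n => (z n).1

/-- The payoff of an infinite history: the sum of the daily payoffs of its finite prefixes. -/
def payoff (G : PursuitEvasionGame A₁ A₂ S₁ S₂) (h : ℕ → A₁ × A₂) : ℝ≥0∞ :=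
  ∑' n : ℕ, (G.f n (fun i : Fin n => h i) : ℝ≥0∞)

/-- The expected payoff of a profile. -/
def expectedPayoff (G : PursuitEvasionGame A₁ A₂ S₁ S₂)
    (σ₁ : BehavioralStrategy A₁ S₁) (σ₂ : BehavioralStrategy A₂ S₂) : ℝ≥0∞ :=
  ∫⁻ h, G.payoff h ∂(G.historyMeasure σ₁ σ₂)

/-- The value of a strategy of the Maximizer. -/
def val₁ (G : PursuitEvasionGame A₁ A₂ S₁ S₂) (σ₁ : BehavioralStrategy A₁ S₁) : ℝ≥0∞ :=
  ⨅ σ₂ : BehavioralStrategy A₂ S₂, G.expectedPayoff σ₁ σ₂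

/-- The value of a strategy of the Minimizer. -/
def val₂ (G : PursuitEvasionGame A₁ A₂ S₁ S₂) (σ₂ : BehavioralStrategy A₂ S₂) : ℝ≥0∞ :=
  ⨆ σ₁ : BehavioralStrategy A₁ S₁, G.expectedPayoff σ₁ σ₂

/-- The lower value of the game. -/
def lowerVal (G : PursuitEvasionGame A₁ A₂ S₁ S₂) : ℝ≥0∞ :=
  ⨆ σ₁ : BehavioralStrategy A₁ S₁, G.val₁ σ₁

/-- The upper value of the game. -/
def upperVal (G : PursuitEvasionGame A₁ A₂ S₁ S₂) : ℝ≥0∞ :=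
  ⨅ σ₂ : BehavioralStrategy A₂ S₂, G.val₂ σ₂

/-- `v` is the value of the game: a finite number equal to the lower and to the upper value. -/
def IsValue (G : PursuitEvasionGame A₁ A₂ S₁ S₂) (v : ℝ≥0) : Prop :=
  G.lowerVal = v ∧ G.upperVal = v

/-- `σ₁` is `ε`-optimal for the Maximizer: the game has a value `v` and
`|val(σ₁) - v| < ε`, written without subtraction. -/
def IsEpsOptimal₁ (G : PursuitEvasionGame A₁ A₂ S₁ S₂) (ε : ℝ≥0)
    (σ₁ : BehavioralStrategy A₁ S₁) : Prop :=
  ∃ v : ℝ≥0, G.IsValue v ∧ G.val₁ σ₁ < v + ε ∧ (v : ℝ≥0∞) < G.val₁ σ₁ + ε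

/-- `σ₂` is `ε`-optimal for the Minimizer: the game has a value `v` and
`|val(σ₂) - v| < ε`, written without subtraction. -/
def IsEpsOptimal₂ (G : PursuitEvasionGame A₁ A₂ S₁ S₂) (ε : ℝ≥0)
    (σ₂ : BehavioralStrategy A₂ S₂) : Prop :=
  ∃ v : ℝ≥0, G.IsValue v ∧ G.val₂ σ₂ < v + ε ∧ (v : ℝ≥0∞) < G.val₂ σ₂ + ε

/-- The game `G_n`: daily payoffs of histories of length more than `n` are replaced by zero. -/
def truncate (G : PursuitEvasionGame A₁ A₂ S₁ S₂) (n : ℕ) : PursuitEvasionGame A₁ A₂ S₁ S₂ where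
  f m h := if m ≤ n then G.f m h else 0
  p₁ := G.p₁
  p₂ := G.p₂

/-- The payoff function is bounded on the set of infinite histories. -/
def IsBounded (G : PursuitEvasionGame A₁ A₂ S₁ S₂) : Prop :=
  ∃ B : ℝ≥0, ∀ h : ℕ → A₁ × A₂, G.payoff h < B

/-- The game has a value, and for each `ε > 0` both players have strategies that are `ε`-optimal
in all sufficiently long truncations of the game. -/
def HasUniformValue (G : PursuitEvasionGame A₁ A₂ S₁ S₂) : Prop :=
  (∃ v : ℝ≥0, G.IsValue v) ∧
    ∀ ε : ℝ≥0, 0 < ε → ∃ (N : ℕ) (σ₁ : BehavioralStrategy A₁ S₁) (σ₂ : BehavioralStrategy A₂ S₂),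
      ∀ n : ℕ, N < n → (G.truncate n).IsEpsOptimal₁ ε σ₁ ∧ (G.truncate n).IsEpsOptimal₂ ε σ₂

end play

end PursuitEvasionGame

end

/-! Signals are drawn independently from laws that depend only on the public history. Hence, given
that history, the private histories are independent, and the probability of a finite public history
is a product of one factor per player (`lintegral_prefixLaw`, `prefixLaw_hist`). Each player is thus
summarized by a vector of realization probabilities indexed by the countably many public histories,
and the payoff of every truncation is a continuous bilinear form in the two vectors
(`expectedPayoff_truncate`).

The vectors realizable by strategies form a convex compact set in the product topology. Convexity
comes from realization plans, which satisfy linear flow equations and correspond to strategies as in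
Kuhn's theorem (`realizationSet_eq_image`). Compactness is the delicate point, as the signal spaces
carry no topology: nearly norm-minimal points of decreasing convex sets in L² form a Cauchy
sequence, which yields an a.e. limit plan (`isClosed_realizationSet`).

Sion's theorem then gives optimal strategies in each truncation. Since daily payoffs are
nonnegative, the values increase, and boundedness makes their limit `w` finite. An optimal strategy
of the Maximizer in one long truncation stays good in all longer ones. For the Minimizer, the
vectors guaranteeing `w` in the first `n` truncations form decreasing nonempty compact sets, and a
common point gives one strategy that works in all of them (`exists_uniform_strategy`). -/

noncomputable section

namespace PursuitEvasionGame

/-! ### Private histories conditioned on the public history. -/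

section observation

variable {A S B : Type*} [MeasurableSpace A] [MeasurableSpace S]

lemma measurable_snoc_pair {X Y : Type*} [MeasurableSpace X] [MeasurableSpace Y] {n : ℕ}
    {f : Y → Fin n → X} {g : Y → X} (hf : Measurable f) (hg : Measurable g) :
    Measurable (fun y => (Fin.snoc (f y) (g y) : Fin (n + 1) → X)) := by
  refine measurable_pi_lambda _ fun i => ?_
  refine Fin.lastCases ?_ (fun j => ?_) i
  · simpa only [Fin.snoc_last] using hg
  · simp only [Fin.snoc_castSucc]
    exact (measurable_pi_apply j).comp hf

lemma measurable_init {X : Type*} [MeasurableSpace X] {n : ℕ} :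
    Measurable (fun z : Fin (n + 1) → X => (Fin.init z : Fin n → X)) :=
  measurable_pi_lambda _ fun _ => measurable_pi_apply _

/-- The law of the private history of a player with action projection `π` and signal laws `p`,
given the public history. -/
def obsLaw (π : B → A) (p : ∀ n : ℕ, (Fin n → B) → ProbabilityMeasure S) :
    ∀ n : ℕ, (Fin n → B) → Measure (Fin n → A × S)
  | 0, _ => Measure.dirac Fin.elim0
  | n + 1, h => ((obsLaw π p n (Fin.init h)).prod (p (n + 1) h : Measure S)).map
      fun x => Fin.snoc x.1 (π (h (Fin.last n)), x.2)

variable (π : B → A) (p : ∀ n : ℕ, (Fin n → B) → ProbabilityMeasure S)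

lemma measurable_snoc_signal (a : A) (n : ℕ) :
    Measurable (fun x : (Fin n → A × S) × S => (Fin.snoc x.1 (a, x.2) : Fin (n + 1) → A × S)) :=
  measurable_snoc_pair measurable_fst (measurable_const.prodMk measurable_snd)

instance isProbabilityMeasure_obsLaw (n : ℕ) (h : Fin n → B) :
    IsProbabilityMeasure (obsLaw π p n h) := by
  induction n with
  | zero => unfold obsLaw; infer_instance
  | succ n ih =>
    have := ih (Fin.init h)
    unfold obsLaw
    exact Measure.isProbabilityMeasure_map (measurable_snoc_signal _ n).aemeasurable

lemma lintegral_obsLaw_succ {n : ℕ} (h : Fin (n + 1) → B) {g : (Fin (n + 1) → A × S) → ℝ≥0∞}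
    (hg : Measurable g) :
    ∫⁻ z, g z ∂obsLaw π p (n + 1) h =
      ∫⁻ z, ∫⁻ s, g (Fin.snoc z (π (h (Fin.last n)), s)) ∂(p (n + 1) h : Measure S)
        ∂obsLaw π p n (Fin.init h) := by
  rw [obsLaw, lintegral_map hg (measurable_snoc_signal _ n),
    lintegral_prod]
  exact (hg.comp (measurable_snoc_signal _ n)).aemeasurable

lemma map_init_obsLaw {n : ℕ} (h : Fin (n + 1) → B) :
    (obsLaw π p (n + 1) h).map (fun z => (Fin.init z : Fin n → A × S)) =
      obsLaw π p n (Fin.init h) := by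
  rw [obsLaw, Measure.map_map measurable_init (measurable_snoc_signal _ n)]
  have : ((fun z : Fin (n + 1) → A × S => (Fin.init z : Fin n → A × S)) ∘
      fun x : (Fin n → A × S) × S => Fin.snoc x.1 (π (h (Fin.last n)), x.2)) = Prod.fst := by
    funext x; simp
  rw [this, ← Measure.fst, Measure.fst_prod]

/-- Dropping the last observation pushes `obsLaw` forward to `obsLaw`, so null sets of shorter
private histories lift. The a.e. flow equations, which relate a history to its parent, depend on
this. -/
lemma ae_obsLaw_init {n : ℕ} (h : Fin (n + 1) → B) {P : (Fin n → A × S) → Prop}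
    (hP : ∀ᵐ z ∂obsLaw π p n (Fin.init h), P z) :
    ∀ᵐ z ∂obsLaw π p (n + 1) h, P (Fin.init z) := by
  rw [← map_init_obsLaw] at hP
  exact ae_of_ae_map measurable_init.aemeasurable hP

/-- The product of the probabilities with which the strategy `σ` plays the successive actions of
a private history. -/
def reachWeight (σ : BehavioralStrategy A S) : ∀ n : ℕ, (Fin n → A × S) → ℝ≥0∞
  | 0, _ => 1
  | n + 1, z => reachWeight σ n (Fin.init z) * σ.act n (Fin.init z) {(z (Fin.last n)).1}

lemma measurable_kernel_singleton [DiscreteMeasurableSpace A] [Finite A]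
    {Y : Type*} [MeasurableSpace Y] (κ : Kernel Y A) :
    Measurable (fun x : Y × A => κ x.1 {x.2}) :=
  measurable_from_prod_countable_left fun a =>
    κ.measurable_coe (MeasurableSet.of_discrete (s := {a}))

lemma measurable_reachWeight [DiscreteMeasurableSpace A] [Finite A] (σ : BehavioralStrategy A S)
    (n : ℕ) : Measurable (reachWeight σ n) := by
  induction n with
  | zero => exact measurable_const
  | succ n ih =>
    refine (ih.comp measurable_init).mul ((measurable_kernel_singleton (σ.act n)).comp
      (measurable_init.prodMk (measurable_fst.comp (measurable_pi_apply (Fin.last n)))))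

lemma reachWeight_le_one (σ : BehavioralStrategy A S) (n : ℕ) (z : Fin n → A × S) :
    reachWeight σ n z ≤ 1 := by
  induction n with
  | zero => exact le_rfl
  | succ n ih => exact mul_le_one' (ih _) prob_le_one

/-- The probability that a player using `σ` plays its part of the public history `h`, if the
other player plays its part. -/
def realization (σ : BehavioralStrategy A S) (n : ℕ) (h : Fin n → B) : ℝ≥0∞ :=
  ∫⁻ z, reachWeight σ n z ∂obsLaw π p n h

lemma realization_le_one (σ : BehavioralStrategy A S) (n : ℕ) (h : Fin n → B) :
    realization π p σ n h ≤ 1 :=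
  (lintegral_mono (reachWeight_le_one σ n)).trans (by simp)

lemma lintegral_reachWeight_succ [DiscreteMeasurableSpace A] [Finite A]
    (σ : BehavioralStrategy A S) {n : ℕ} (h : Fin (n + 1) → B)
    {g : (Fin (n + 1) → A × S) → ℝ≥0∞} (hg : Measurable g) :
    ∫⁻ z, reachWeight σ (n + 1) z * g z ∂obsLaw π p (n + 1) h =
      ∫⁻ z, reachWeight σ n z * (σ.act n z {π (h (Fin.last n))} *
        ∫⁻ s, g (Fin.snoc z (π (h (Fin.last n)), s)) ∂(p (n + 1) h : Measure S))
        ∂obsLaw π p n (Fin.init h) := by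
  refine (lintegral_obsLaw_succ π p h ((measurable_reachWeight σ _).mul hg)).trans ?_
  refine lintegral_congr fun z => ?_
  simp only [Pi.mul_apply, reachWeight, Fin.init_snoc, Fin.snoc_last]
  rw [lintegral_const_mul, mul_assoc]
  exact hg.comp ((measurable_snoc_signal _ n).comp measurable_prodMk_left)

end observation

section snoc

variable {A₁ A₂ S₁ S₂ : Type*}

lemma hist_snoc {n : ℕ} (z : Fin n → Stage A₁ A₂ S₁ S₂) (x : Stage A₁ A₂ S₁ S₂) :
    hist (Fin.snoc z x : Fin (n + 1) → _) = Fin.snoc (hist z) x.1 := by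
  funext i
  refine Fin.lastCases ?_ (fun j => ?_) i <;> simp [hist]

lemma priv₁_snoc {n : ℕ} (z : Fin n → Stage A₁ A₂ S₁ S₂) (x : Stage A₁ A₂ S₁ S₂) :
    priv₁ (Fin.snoc z x : Fin (n + 1) → _) = Fin.snoc (priv₁ z) (x.1.1, x.2.1) := by
  funext i
  refine Fin.lastCases ?_ (fun j => ?_) i <;> simp [priv₁]

lemma priv₂_snoc {n : ℕ} (z : Fin n → Stage A₁ A₂ S₁ S₂) (x : Stage A₁ A₂ S₁ S₂) :
    priv₂ (Fin.snoc z x : Fin (n + 1) → _) = Fin.snoc (priv₂ z) (x.1.2, x.2.2) := by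
  funext i
  refine Fin.lastCases ?_ (fun j => ?_) i <;> simp [priv₂]

lemma measurable_hist [MeasurableSpace A₁] [MeasurableSpace A₂] [MeasurableSpace S₁]
    [MeasurableSpace S₂] (n : ℕ) :
    Measurable (hist : (Fin n → Stage A₁ A₂ S₁ S₂) → Fin n → A₁ × A₂) := by
  unfold hist; fun_prop

end snoc

/-! ### Factorization of the law of play over the two players. -/

section play

variable {A₁ A₂ S₁ S₂ : Type*}
  [MeasurableSpace A₁] [DiscreteMeasurableSpace A₁] [Finite A₁]
  [MeasurableSpace A₂] [DiscreteMeasurableSpace A₂] [Finite A₂]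
  [MeasurableSpace S₁] [MeasurableSpace S₂]
  (G : PursuitEvasionGame A₁ A₂ S₁ S₂)
  (σ₁ : BehavioralStrategy A₁ S₁) (σ₂ : BehavioralStrategy A₂ S₂)

instance : IsProbabilityMeasure (G.playMeasure σ₁ σ₂) := by
  unfold playMeasure; infer_instance

/-- The law of the first `n` stages. -/
def prefixLaw (n : ℕ) : Measure (Fin n → Stage A₁ A₂ S₁ S₂) :=
  (G.playMeasure σ₁ σ₂).map fun z i => z i

lemma measurable_prefix {X : Type*} [MeasurableSpace X] (n : ℕ) :
    Measurable (fun (z : ℕ → X) (i : Fin n) => z i) :=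
  measurable_pi_lambda _ fun _ => measurable_pi_apply _

instance (n : ℕ) : IsProbabilityMeasure (G.prefixLaw σ₁ σ₂ n) :=
  Measure.isProbabilityMeasure_map (measurable_prefix n).aemeasurable

lemma playMeasure_map_eval_zero :
    (G.playMeasure σ₁ σ₂).map (fun z => z 0) = G.stageKernel σ₁ σ₂ 0 Fin.elim0 := by
  have h : (fun z : ℕ → Stage A₁ A₂ S₁ S₂ => z 0) =
      (fun x : (Finset.Iic 0 → Stage A₁ A₂ S₁ S₂) => x ⟨0, by simp⟩) ∘
        Preorder.frestrictLe (π := fun _ => Stage A₁ A₂ S₁ S₂) 0 := rfl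
  rw [h, ← Measure.map_map (measurable_pi_apply _) (by fun_prop), playMeasure,
    Kernel.trajMeasure, Measure.map_comp _ _ (by fun_prop), Kernel.traj_map_frestrictLe,
    Kernel.partialTraj_self, Measure.id_comp, Measure.map_map (measurable_pi_apply _) (by fun_prop)]
  exact Measure.map_id

/-- Tower property for the last stage, which makes induction on the number of stages possible. -/
lemma lintegral_prefixLaw_succ (n : ℕ) {g : (Fin (n + 1) → Stage A₁ A₂ S₁ S₂) → ℝ≥0∞}
    (hg : Measurable g) :
    ∫⁻ z, g z ∂G.prefixLaw σ₁ σ₂ (n + 1) =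
      ∫⁻ z, ∫⁻ x, g (Fin.snoc z x) ∂G.stageKernel σ₁ σ₂ n z ∂G.prefixLaw σ₁ σ₂ n := by
  have hsnoc : Measurable (fun x : (Fin n → Stage A₁ A₂ S₁ S₂) × Stage A₁ A₂ S₁ S₂ =>
      (Fin.snoc x.1 x.2 : Fin (n + 1) → Stage A₁ A₂ S₁ S₂)) :=
    measurable_snoc_pair measurable_fst measurable_snd
  have hmeas : Measurable (fun z => ∫⁻ x, g (Fin.snoc z x) ∂G.stageKernel σ₁ σ₂ n z) :=
    Measurable.lintegral_kernel_prod_right' (f := fun x => g (Fin.snoc x.1 x.2)) (hg.comp hsnoc)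
  rw [prefixLaw, lintegral_map hg (measurable_prefix _), prefixLaw,
    lintegral_map hmeas (measurable_prefix _)]
  have hsplit (z : ℕ → Stage A₁ A₂ S₁ S₂) : (fun i : Fin (n + 1) => z i) =
      (Fin.snoc (fun i : Fin n => z i) (z n) : Fin (n + 1) → Stage A₁ A₂ S₁ S₂) := by
    funext i
    refine Fin.lastCases ?_ (fun j => ?_) i <;> simp
  -- `trajMeasure` takes stage `0` from its initial measure and only later stages from `stepKernel`,
  -- whose index lags by one.
  cases n with
  | zero =>
    have h0 : ∀ z : Fin 0 → Stage A₁ A₂ S₁ S₂, z = Fin.elim0 := fun z => Subsingleton.elim _ _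
    simp only [hsplit, h0 (fun i : Fin 0 => _)]
    rw [lintegral_const, measure_univ, mul_one, ← playMeasure_map_eval_zero, lintegral_map]
    · exact hg.comp (hsnoc.comp (measurable_prodMk_left (x := Fin.elim0)))
    · exact measurable_pi_apply 0
  | succ n =>
    let r : (Finset.Iic n → Stage A₁ A₂ S₁ S₂) → Fin (n + 1) → Stage A₁ A₂ S₁ S₂ :=
      fun x i => x ⟨(i : ℕ), Finset.mem_Iic.2 (Nat.le_of_lt_succ i.isLt)⟩
    have hr : Measurable r := measurable_pi_lambda _ fun _ => measurable_pi_apply _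
    have key := Kernel.map_frestrictLe_trajMeasure_compProd_eq_map_trajMeasure
      (X := fun _ => Stage A₁ A₂ S₁ S₂) (μ₀ := G.stageKernel σ₁ σ₂ 0 Fin.elim0)
      (κ := G.stepKernel σ₁ σ₂) (a := n)
    have hφ : Measurable (fun x : (Finset.Iic n → Stage A₁ A₂ S₁ S₂) × Stage A₁ A₂ S₁ S₂ =>
        g (Fin.snoc (r x.1) x.2)) :=
      hg.comp (hsnoc.comp ((hr.comp measurable_fst).prodMk measurable_snd))
    have := congrArg (fun μ => ∫⁻ x, g (Fin.snoc (r x.1) x.2) ∂μ) key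
    rw [Measure.lintegral_compProd hφ, lintegral_map hφ (by fun_prop),
      lintegral_map (Measurable.lintegral_kernel_prod_right' hφ) (by fun_prop)] at this
    simp only [hsplit]
    exact this.symm

/-- Fixing the action pair fixes the new public history, so the signal law becomes a fixed product
measure; the action law is a product too. -/
lemma lintegral_stageKernel {n : ℕ} (h : Fin (n + 1) → A₁ × A₂) (z : Fin n → Stage A₁ A₂ S₁ S₂)
    (hz : hist z = Fin.init h)
    {g₁ : (Fin (n + 1) → A₁ × S₁) → ℝ≥0∞} (hg₁ : Measurable g₁)
    {g₂ : (Fin (n + 1) → A₂ × S₂) → ℝ≥0∞} (hg₂ : Measurable g₂) :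
    ∫⁻ x, {x | x.1 = h (Fin.last n)}.indicator (fun x => g₁ (Fin.snoc (priv₁ z) (x.1.1, x.2.1)) *
        g₂ (Fin.snoc (priv₂ z) (x.1.2, x.2.2))) x ∂G.stageKernel σ₁ σ₂ n z =
      (σ₁.act n (priv₁ z) {(h (Fin.last n)).1} *
        ∫⁻ s, g₁ (Fin.snoc (priv₁ z) ((h (Fin.last n)).1, s)) ∂(G.p₁ (n + 1) h : Measure S₁)) *
      (σ₂.act n (priv₂ z) {(h (Fin.last n)).2} *
        ∫⁻ s, g₂ (Fin.snoc (priv₂ z) ((h (Fin.last n)).2, s)) ∂(G.p₂ (n + 1) h : Measure S₂)) := by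
  have hm₁ : Measurable fun x : A₁ × S₁ => g₁ (Fin.snoc (priv₁ z) x) :=
    hg₁.comp (measurable_snoc_pair measurable_const measurable_id)
  have hm₂ : Measurable fun x : A₂ × S₂ => g₂ (Fin.snoc (priv₂ z) x) :=
    hg₂.comp (measurable_snoc_pair measurable_const measurable_id)
  have hm : Measurable (fun x : Stage A₁ A₂ S₁ S₂ => g₁ (Fin.snoc (priv₁ z) (x.1.1, x.2.1)) *
      g₂ (Fin.snoc (priv₂ z) (x.1.2, x.2.2))) :=
    (hm₁.comp (by fun_prop : Measurable fun x : Stage A₁ A₂ S₁ S₂ => (x.1.1, x.2.1))).mul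
      (hm₂.comp (by fun_prop : Measurable fun x : Stage A₁ A₂ S₁ S₂ => (x.1.2, x.2.2)))
  have hset : MeasurableSet {x : Stage A₁ A₂ S₁ S₂ | x.1 = h (Fin.last n)} :=
    measurable_fst (MeasurableSet.of_discrete (s := {h (Fin.last n)}))
  rw [stageKernel, Kernel.lintegral_compProd _ _ _ (hm.indicator hset)]
  have hinner : ∀ a : A₁ × A₂, ∫⁻ s, {x : Stage A₁ A₂ S₁ S₂ | x.1 = h (Fin.last n)}.indicator
      (fun x => g₁ (Fin.snoc (priv₁ z) (x.1.1, x.2.1)) *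
        g₂ (Fin.snoc (priv₂ z) (x.1.2, x.2.2))) (a, s)
        ∂((G.signalKernel (n + 1)).comap (nextHist n) (measurable_nextHist n)) (z, a) =
      ({h (Fin.last n)} : Set (A₁ × A₂)).indicator (fun _ =>
        (∫⁻ s, g₁ (Fin.snoc (priv₁ z) ((h (Fin.last n)).1, s)) ∂(G.p₁ (n + 1) h : Measure S₁)) *
        ∫⁻ s, g₂ (Fin.snoc (priv₂ z) ((h (Fin.last n)).2, s))
          ∂(G.p₂ (n + 1) h : Measure S₂)) a := by
    intro a
    by_cases ha : a = h (Fin.last n)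
    · subst ha
      have hnext : nextHist n (z, h (Fin.last n)) = h := by simp [nextHist, hz]
      have hsig : G.signalKernel (n + 1) h =
        (G.p₁ (n + 1) h : Measure S₁).prod (G.p₂ (n + 1) h : Measure S₂) := rfl
      simp only [Set.indicator, Set.mem_ofPred_eq, if_true, Set.mem_singleton_iff,
        Kernel.comap_apply, hnext, hsig]
      exact lintegral_prod_mul (hm₁.comp measurable_prodMk_left).aemeasurable
        (hm₂.comp measurable_prodMk_left).aemeasurable
    · simp [Set.indicator, ha]
  have hprod : actionKernel σ₁ σ₂ n z {h (Fin.last n)} =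
      σ₁.act n (priv₁ z) {(h (Fin.last n)).1} * σ₂.act n (priv₂ z) {(h (Fin.last n)).2} := by
    rw [actionKernel, Kernel.prod_apply, Kernel.comap_apply, Kernel.comap_apply,
      ← Measure.prod_prod, Set.singleton_prod_singleton]
  simp only [hinner]
  rw [lintegral_indicator MeasurableSet.of_discrete, setLIntegral_const, hprod]
  ring

/-- Given the public history, the private histories are independent, and the probability of the
public history factorizes over the players. -/
theorem lintegral_prefixLaw (n : ℕ) (h : Fin n → A₁ × A₂)
    {g₁ : (Fin n → A₁ × S₁) → ℝ≥0∞} (hg₁ : Measurable g₁)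
    {g₂ : (Fin n → A₂ × S₂) → ℝ≥0∞} (hg₂ : Measurable g₂) :
    ∫⁻ z, {z | hist z = h}.indicator (fun z => g₁ (priv₁ z) * g₂ (priv₂ z)) z
        ∂G.prefixLaw σ₁ σ₂ n =
      (∫⁻ z, reachWeight σ₁ n z * g₁ z ∂obsLaw Prod.fst G.p₁ n h) *
        ∫⁻ z, reachWeight σ₂ n z * g₂ z ∂obsLaw Prod.snd G.p₂ n h := by
  induction n with
  | zero =>
    have hz : ∀ z : Fin 0 → Stage A₁ A₂ S₁ S₂, hist z = h ∧ priv₁ z = Fin.elim0 ∧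
      priv₂ z = Fin.elim0 := fun z => ⟨Subsingleton.elim _ _, Subsingleton.elim _ _,
        Subsingleton.elim _ _⟩
    simp only [Set.indicator, Set.mem_ofPred_eq, hz, if_true, lintegral_const, measure_univ,
      mul_one, reachWeight, one_mul, obsLaw]
    rw [lintegral_dirac' _ hg₁, lintegral_dirac' _ hg₂]
  | succ n ih =>
    have hset : MeasurableSet {z : Fin (n + 1) → Stage A₁ A₂ S₁ S₂ | hist z = h} :=
      measurable_hist _ (MeasurableSet.of_discrete (s := {h}))
    refine (lintegral_prefixLaw_succ _ _ _ _ (((hg₁.comp (measurable_priv₁ _)).mul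
        (hg₂.comp (measurable_priv₂ _))).indicator hset)).trans ?_
    rw [lintegral_reachWeight_succ _ _ _ _ hg₁, lintegral_reachWeight_succ _ _ _ _ hg₂]
    have hm₁ : Measurable fun z : Fin n → A₁ × S₁ => σ₁.act n z {(h (Fin.last n)).1} *
        ∫⁻ s, g₁ (Fin.snoc z ((h (Fin.last n)).1, s)) ∂(G.p₁ (n + 1) h : Measure S₁) :=
      ((σ₁.act n).measurable_coe MeasurableSet.of_discrete).mul
        (hg₁.comp (measurable_snoc_signal _ n)).lintegral_prod_right'
    have hm₂ : Measurable fun z : Fin n → A₂ × S₂ => σ₂.act n z {(h (Fin.last n)).2} *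
        ∫⁻ s, g₂ (Fin.snoc z ((h (Fin.last n)).2, s)) ∂(G.p₂ (n + 1) h : Measure S₂) :=
      ((σ₂.act n).measurable_coe MeasurableSet.of_discrete).mul
        (hg₂.comp (measurable_snoc_signal _ n)).lintegral_prod_right'
    -- The induction hypothesis is used for the test functions left after integrating out the last
    -- action and signal; hence the statement allows arbitrary `g₁` and `g₂`.
    rw [← ih (Fin.init h) hm₁ hm₂]
    refine lintegral_congr fun z => ?_
    by_cases hz : hist z = Fin.init h
    · rw [Set.indicator_of_mem (by exact hz), ← lintegral_stageKernel G σ₁ σ₂ h z hz hg₁ hg₂]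
      refine lintegral_congr fun x => ?_
      have : hist (Fin.snoc z x : Fin (n + 1) → _) = h ↔ x.1 = h (Fin.last n) := by
        rw [hist_snoc, hz]
        refine ⟨fun e => by simpa using congrFun e (Fin.last n), fun e => ?_⟩
        rw [e, Fin.snoc_init_self]
      by_cases hx : x.1 = h (Fin.last n)
      · rw [Set.indicator_of_mem (by exact this.2 hx), Set.indicator_of_mem (by exact hx)]
        simp only [Pi.mul_apply, Function.comp_apply, priv₁_snoc, priv₂_snoc]
      · rw [Set.indicator_of_notMem (by exact fun e => hx (this.1 e)),
          Set.indicator_of_notMem (by exact hx)]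
    · rw [Set.indicator_of_notMem (by exact hz)]
      refine (lintegral_congr fun x => ?_).trans lintegral_zero
      refine Set.indicator_of_notMem (fun hx => hz ?_) _
      rw [Set.mem_ofPred_eq, hist_snoc] at hx
      rw [← hx, Fin.init_snoc]

lemma prefixLaw_hist (n : ℕ) (h : Fin n → A₁ × A₂) :
    G.prefixLaw σ₁ σ₂ n {z | hist z = h} =
      realization Prod.fst G.p₁ σ₁ n h * realization Prod.snd G.p₂ σ₂ n h := by
  have := lintegral_prefixLaw G σ₁ σ₂ n h (g₁ := fun _ => 1) (g₂ := fun _ => 1)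
    measurable_const measurable_const
  simp only [mul_one] at this
  rw [realization, realization, ← this, ← lintegral_indicator_one]
  · rfl
  · exact measurable_hist _ (MeasurableSet.of_discrete (s := {h}))

lemma lintegral_hist [Fintype A₁] [Fintype A₂] (n : ℕ) (f : (Fin n → A₁ × A₂) → ℝ≥0∞) :
    ∫⁻ z, f (hist z) ∂G.prefixLaw σ₁ σ₂ n =
      ∑ h, f h * (realization Prod.fst G.p₁ σ₁ n h * realization Prod.snd G.p₂ σ₂ n h) := by
  rw [← lintegral_map (f := f) (measurable_of_countable _) (measurable_hist n), lintegral_fintype]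
  refine Finset.sum_congr rfl fun h _ => ?_
  rw [Measure.map_apply (measurable_hist n) (MeasurableSet.of_discrete), ← prefixLaw_hist]
  rfl

theorem expectedPayoff_eq_tsum [Fintype A₁] [Fintype A₂] :
    G.expectedPayoff σ₁ σ₂ = ∑' n : ℕ, ∑ h : Fin n → A₁ × A₂, (G.f n h : ℝ≥0∞) *
      (realization Prod.fst G.p₁ σ₁ n h * realization Prod.snd G.p₂ σ₂ n h) := by
  have hm : Measurable fun (z : ℕ → Stage A₁ A₂ S₁ S₂) (n : ℕ) => (z n).1 := by fun_prop
  have hf : ∀ n, Measurable fun h : ℕ → A₁ × A₂ => (G.f n (fun i : Fin n => h i) : ℝ≥0∞) :=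
    fun n => (measurable_of_countable fun h => (G.f n h : ℝ≥0∞)).comp (measurable_prefix n)
  rw [expectedPayoff, historyMeasure]
  simp only [payoff]
  rw [lintegral_map (Measurable.tsum hf) hm, lintegral_tsum]
  · refine tsum_congr fun n => ?_
    rw [← lintegral_hist G σ₁ σ₂ n fun h => (G.f n h : ℝ≥0∞), prefixLaw, lintegral_map]
    · rfl
    · exact (measurable_of_countable fun h => (G.f n h : ℝ≥0∞)).comp (measurable_hist n)
    · exact measurable_prefix n
  · exact fun n => ((hf n).comp hm).aemeasurable

end play

/-! ### Convergent selections from decreasing convex sets. -/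

section selection

open Filter Topology

/-- In a Hilbert space, a decreasing sequence of nonempty bounded convex sets admits a convergent
sequence of points, the `k`-th one in the `k`-th set. -/
lemma exists_seq_tendsto_of_antitone_convex {E : Type*} [NormedAddCommGroup E]
    [InnerProductSpace ℝ E] [CompleteSpace E] {D : ℕ → Set E} (hanti : Antitone D)
    (hconv : ∀ k, Convex ℝ (D k)) (hne : ∀ k, (D k).Nonempty) {R : ℝ}
    (hR : ∀ x ∈ D 0, ‖x‖ ≤ R) :
    ∃ (x : ℕ → E) (l : E), (∀ k, x k ∈ D k) ∧ Tendsto x atTop (𝓝 l) := by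
  set d : ℕ → ℝ := fun k => sInf ((fun x => ‖x‖ ^ 2) '' D k) with hd
  have hbdd : ∀ k, BddBelow ((fun x => ‖x‖ ^ 2) '' D k) := fun k =>
    ⟨0, by rintro _ ⟨x, -, rfl⟩; positivity⟩
  have hle : ∀ k, ∀ x ∈ D k, d k ≤ ‖x‖ ^ 2 := fun k x hx =>
    csInf_le (hbdd k) (Set.mem_image_of_mem _ hx)
  have hmono : Monotone d := fun j k hjk =>
    csInf_le_csInf (hbdd j) ((hne k).image _) (Set.image_mono (hanti hjk))
  have hub : BddAbove (Set.range d) := by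
    refine ⟨R ^ 2, ?_⟩
    rintro _ ⟨k, rfl⟩
    obtain ⟨x, hx⟩ := hne k
    exact (hle k x hx).trans (pow_le_pow_left₀ (norm_nonneg _) (hR x (hanti (Nat.zero_le k) hx)) 2)
  have hlim := tendsto_atTop_ciSup hmono hub
  set D' := ⨆ k, d k
  -- The sets need not be closed, so the minimal norm is only approached; accordingly the limit need
  -- not lie in any `D k`.
  have hch : ∀ k : ℕ, ∃ x ∈ D k, ‖x‖ ^ 2 < d k + 1 / ((k : ℝ) + 1) := by
    intro k
    obtain ⟨_, ⟨x, hx, rfl⟩, hlt⟩ := exists_lt_of_csInf_lt ((hne k).image (fun x => ‖x‖ ^ 2))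
      (lt_add_of_pos_right (d k) (by positivity : (0 : ℝ) < 1 / ((k : ℝ) + 1)))
    exact ⟨x, hx, hlt⟩
  choose x hxD hx using hch
  have hcauchy : CauchySeq x := by
    refine cauchySeq_of_le_tendsto_0' (fun k => √(2 * (D' - d k) + 4 * (1 / ((k : ℝ) + 1)))) ?_ ?_
    · intro k j hkj
      rw [dist_eq_norm]
      refine Real.le_sqrt_of_sq_le ?_
      -- The midpoint has squared norm at least `d k`, so the parallelogram law bounds `‖x k - x j‖
      -- ^ 2` by `2 * (d j - d k) + 4 / (k + 1)`.
      have hmid : (1 / 2 : ℝ) • x k + (1 / 2 : ℝ) • x j ∈ D k :=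
        hconv k (hxD k) (hanti hkj (hxD j)) (by norm_num) (by norm_num) (by norm_num)
      have h1 := hle k _ hmid
      rw [← smul_add, norm_smul, mul_pow] at h1
      have h2 := parallelogram_law_with_norm ℝ (x k) (x j)
      have h3 : 1 / ((j : ℝ) + 1) ≤ 1 / ((k : ℝ) + 1) :=
        one_div_le_one_div_of_le (by positivity) (by gcongr)
      have h4 : d j ≤ D' := le_ciSup hub j
      have h5 := hx k
      have h6 := hx j
      norm_num at h1
      nlinarith
    · have : Tendsto (fun k : ℕ => 2 * (D' - d k) + 4 * (1 / ((k : ℝ) + 1))) atTop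
          (𝓝 (2 * (D' - D') + 4 * 0)) :=
        ((tendsto_const_nhds.sub hlim).const_mul 2).add
          (tendsto_one_div_add_atTop_nhds_zero_nat.const_mul 4)
      have h := (Real.continuous_sqrt.tendsto _).comp this
      simp only [sub_self, mul_zero, add_zero, Real.sqrt_zero] at h
      exact h
  obtain ⟨l, hl⟩ := cauchySeq_tendsto_of_complete hcauchy
  exact ⟨x, l, hxD, hl⟩

/-- A decreasing sequence of nonempty convex sets of measurable functions with values in `[0, 1]`
admits an almost everywhere convergent sequence, the `k`-th function in the `k`-th set. -/
lemma exists_seq_ae_tendsto_of_antitone_convex {Ω : Type*} [MeasurableSpace Ω] (μ : Measure Ω)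
    [IsFiniteMeasure μ] {C : ℕ → Set (Ω → ℝ)} (hanti : Antitone C)
    (hconv : ∀ k, Convex ℝ (C k)) (hne : ∀ k, (C k).Nonempty)
    (hmeas : ∀ f ∈ C 0, Measurable f) (hbd : ∀ f ∈ C 0, ∀ ω, f ω ∈ Set.Icc (0 : ℝ) 1) :
    ∃ (r : ℕ → Ω → ℝ) (g : Ω → ℝ), (∀ k, r k ∈ C k) ∧ Measurable g ∧
      ∀ᵐ ω ∂μ, Tendsto (fun k => r k ω) atTop (𝓝 (g ω)) := by
  have hbound : ∀ f ∈ C 0, ∀ ω, ‖f ω‖ ≤ 1 := fun f hf ω => by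
    rw [Real.norm_eq_abs, abs_of_nonneg (hbd f hf ω).1]
    exact (hbd f hf ω).2
  have h0 : ∀ k, C k ⊆ C 0 := fun k => hanti (Nat.zero_le k)
  let D : ℕ → Set (Lp ℝ 2 μ) := fun k => {x | ∃ f ∈ C k, x =ᵐ[μ] f}
  have hDanti : Antitone D := fun j k hjk x ⟨f, hf, hxf⟩ => ⟨f, hanti hjk hf, hxf⟩
  have hDconv : ∀ k, Convex ℝ (D k) := by
    rintro k x ⟨f, hf, hxf⟩ y ⟨g, hg, hyg⟩ a b ha hb hab
    refine ⟨a • f + b • g, hconv k hf hg ha hb hab, ?_⟩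
    filter_upwards [hxf, hyg, Lp.coeFn_add (a • x) (b • y), Lp.coeFn_smul a x,
      Lp.coeFn_smul b y] with ω h1 h2 h3 h4 h5
    rw [h3]
    simp [h4, h5, h1, h2]
  have hDne : ∀ k, (D k).Nonempty := by
    intro k
    obtain ⟨f, hf⟩ := hne k
    have : MemLp f 2 μ := MemLp.of_bound (hmeas f (h0 k hf)).aestronglyMeasurable 1
      (ae_of_all _ (hbound f (h0 k hf)))
    exact ⟨this.toLp f, f, hf, this.coeFn_toLp⟩
  have hDR : ∀ x ∈ D 0, ‖x‖ ≤ measureUnivNNReal μ ^ (2 : ℝ≥0∞).toReal⁻¹ * 1 := by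
    rintro x ⟨f, hf, hxf⟩
    refine Lp.norm_le_of_ae_bound zero_le_one ?_
    filter_upwards [hxf] with ω hω
    rw [hω]
    exact hbound f hf ω
  obtain ⟨x, l, hxD, hl⟩ := exists_seq_tendsto_of_antitone_convex hDanti hDconv hDne hDR
  obtain ⟨φ, hφ, hae⟩ := (tendstoInMeasure_of_tendsto_Lp hl).exists_seq_tendsto_ae
  choose f hfC hf using hxD
  -- Passing to a subsequence keeps the `k`-th function in `C k`, because `k ≤ φ k` and the sets
  -- decrease.
  refine ⟨fun k => f (φ k), l, fun k => hanti (hφ.id_le k) (hfC _),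
    (Lp.stronglyMeasurable l).measurable, ?_⟩
  filter_upwards [hae, ae_all_iff.2 hf] with ω h1 h2
  simpa only [h2] using h1

end selection

/-! ### Kernels to finite sets built from weights. -/

section normalize

variable {Y A : Type*} [Fintype A]

/-- The weights `r` divided by their sum, or uniform weights if the sum is zero. -/
def normalize (r : A → ℝ≥0∞) (a : A) : ℝ≥0∞ :=
  if ∑ b, r b = 0 then (Fintype.card A : ℝ≥0∞)⁻¹ else r a / ∑ b, r b

lemma sum_normalize [Nonempty A] {r : A → ℝ≥0∞} (hr : ∑ b, r b ≠ ⊤) :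
    ∑ a, normalize r a = 1 := by
  unfold normalize
  split_ifs with h
  · simp only [Finset.sum_const, Finset.card_univ, nsmul_eq_mul]
    exact ENNReal.mul_inv_cancel (by simp) (by simp)
  · simp_rw [div_eq_mul_inv]
    rw [← Finset.sum_mul, ENNReal.mul_inv_cancel h hr]

/-- Where the total vanishes all weights vanish, so the uniform default is harmless and histories of
weight zero need no separate treatment. -/
lemma sum_mul_normalize {r : A → ℝ≥0∞} (hr : ∑ b, r b ≠ ⊤) (a : A) :
    (∑ b, r b) * normalize r a = r a := by
  unfold normalize
  split_ifs with h
  · rw [h, zero_mul]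
    exact ((Finset.sum_eq_zero_iff.1 h) a (Finset.mem_univ a)).symm
  · exact ENNReal.mul_div_cancel h hr

lemma measurable_normalize [MeasurableSpace Y] {r : Y → A → ℝ≥0∞} (hr : ∀ a, Measurable fun y => r y a) (a : A) :
    Measurable fun y => normalize (r y) a := by
  have hs : Measurable fun y => ∑ b, r y b := Finset.measurable_sum _ fun b _ => hr b
  exact Measurable.ite (hs (measurableSet_singleton 0)) measurable_const ((hr a).div hs)

end normalize

section weights

variable {Y A : Type*} [MeasurableSpace Y] [MeasurableSpace A] [Fintype A]

/-- The kernel to a finite type with given weights. -/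
def kernelOfWeights (q : Y → A → ℝ≥0∞) (hq : ∀ a, Measurable fun y => q y a) : Kernel Y A where
  toFun y := ∑ a, q y a • Measure.dirac a
  measurable' := by
    refine Measure.measurable_of_measurable_coe _ fun s _ => ?_
    simp only [Measure.coe_finsetSum, Finset.sum_apply, Measure.smul_apply, smul_eq_mul]
    exact Finset.measurable_sum _ fun a _ => (hq a).mul_const _

lemma kernelOfWeights_singleton [DiscreteMeasurableSpace A] (q : Y → A → ℝ≥0∞)
    (hq : ∀ a, Measurable fun y => q y a) (y : Y) (a : A) :
    kernelOfWeights q hq y {a} = q y a := by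
  classical
  change (∑ b, q y b • Measure.dirac b) {a} = q y a
  simp only [Measure.coe_finsetSum, Finset.sum_apply, Measure.smul_apply, smul_eq_mul]
  rw [Finset.sum_eq_single a]
  · simp
  · intro b _ hb
    simp [hb]
  · simp

lemma isMarkovKernel_kernelOfWeights (q : Y → A → ℝ≥0∞)
    (hq : ∀ a, Measurable fun y => q y a) (h : ∀ y, ∑ a, q y a = 1) :
    IsMarkovKernel (kernelOfWeights q hq) := by
  refine ⟨fun y => ⟨?_⟩⟩
  change (∑ b, q y b • Measure.dirac b) Set.univ = 1
  simp [h y]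

end weights

/-! ### Realization plans; convexity and compactness of the realization set. -/

section plans

open Filter Topology

variable {A S B : Type*} [MeasurableSpace A] [MeasurableSpace S]

/-- The pairs of a private history and a possible next action. -/
abbrev Decision (A S : Type*) : Type _ := Σ n : ℕ, (Fin n → A × S) × A

lemma measurable_sigma_mk {ι : Type*} {X : ι → Type*} [∀ i, MeasurableSpace (X i)] (i : ι) :
    Measurable (Sigma.mk i : X i → Sigma X) := by
  intro t ht
  exact (MeasurableSpace.measurableSet_iInf.1 ht) i

lemma measurable_of_sigma {ι Y : Type*} {X : ι → Type*} [∀ i, MeasurableSpace (X i)]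
    [MeasurableSpace Y] {f : Sigma X → Y} (hf : ∀ i, Measurable fun x => f ⟨i, x⟩) :
    Measurable f := fun _ ht => MeasurableSpace.measurableSet_iInf.2 fun i => hf i ht

lemma measurable_decision (n : ℕ) (a : A) :
    Measurable fun z : Fin n → A × S => (⟨n, z, a⟩ : Decision A S) :=
  (measurable_sigma_mk n).comp measurable_prodMk_right

variable (π : B → A) (p : ∀ n : ℕ, (Fin n → B) → ProbabilityMeasure S)

/-- A realization plan: the probability of reaching a private history and then playing an action,
as far as it depends on the player's own choices.  The flow equations are only required to hold
almost everywhere. -/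
structure IsPlan [Fintype A] (r : Decision A S → ℝ) : Prop where
  measurable : Measurable r
  mem_Icc : ∀ ω, r ω ∈ Set.Icc (0 : ℝ) 1
  sum_zero : ∀ z, ∑ a, r ⟨0, z, a⟩ = 1
  sum_succ : ∀ (n : ℕ) (h : Fin (n + 1) → B), ∀ᵐ z ∂obsLaw π p (n + 1) h,
    ∑ a, r ⟨n + 1, z, a⟩ = r ⟨n, Fin.init z, (z (Fin.last n)).1⟩

/-- The probabilities of the public histories under a realization plan, if the other player plays
its part of them. -/
def planVector (r : Decision A S → ℝ) : (Σ n : ℕ, Fin n → B) → ℝ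
  | ⟨0, _⟩ => 1
  | ⟨n + 1, h⟩ => ∫ z, r ⟨n, z, π (h (Fin.last n))⟩ ∂obsLaw π p n (Fin.init h)

/-- The probabilities of the public histories under a strategy, if the other player plays its part
of them. -/
def realizationVector (σ : BehavioralStrategy A S) (i : Σ n : ℕ, Fin n → B) : ℝ :=
  (realization π p σ i.1 i.2).toReal

/-- The set of vectors of realization probabilities of the strategies of a player. -/
def realizationSet : Set ((Σ n : ℕ, Fin n → B) → ℝ) :=
  Set.range (realizationVector (A := A) (S := S) π p)

lemma realization_zero (σ : BehavioralStrategy A S) (h : Fin 0 → B) :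
    realization π p σ 0 h = 1 := by
  simp [realization, reachWeight]

lemma reachWeight_mul_le_one (σ : BehavioralStrategy A S) (n : ℕ) (z : Fin n → A × S) (a : A) :
    reachWeight σ n z * σ.act n z {a} ≤ 1 :=
  mul_le_one' (reachWeight_le_one σ n z) prob_le_one

lemma realizationVector_mem_Icc (σ : BehavioralStrategy A S) (i : Σ n : ℕ, Fin n → B) :
    realizationVector π p σ i ∈ Set.Icc (0 : ℝ) 1 :=
  ⟨ENNReal.toReal_nonneg, ENNReal.toReal_le_of_le_ofReal zero_le_one
    (by simpa using realization_le_one π p σ i.1 i.2)⟩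

variable [Fintype A]

lemma IsPlan.integrable {r : Decision A S → ℝ} (hr : IsPlan π p r) (n : ℕ) (a : A)
    (h : Fin n → B) : Integrable (fun z => r ⟨n, z, a⟩) (obsLaw π p n h) :=
  Integrable.of_bound (hr.measurable.comp (measurable_decision n a)).aestronglyMeasurable 1
    (ae_of_all _ fun z => by
      rw [Real.norm_eq_abs, abs_of_nonneg (hr.mem_Icc _).1]
      exact (hr.mem_Icc _).2)

lemma convex_isPlan : Convex ℝ {r : Decision A S → ℝ | IsPlan π p r} := by
  intro r hr r' hr' a b ha hb hab
  refine ⟨(hr.measurable.const_smul a).add (hr'.measurable.const_smul b),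
    fun ω => convex_Icc 0 1 (hr.mem_Icc ω) (hr'.mem_Icc ω) ha hb hab, fun z => ?_, fun n h => ?_⟩
  · simp only [Pi.add_apply, Pi.smul_apply, smul_eq_mul, Finset.sum_add_distrib,
      ← Finset.mul_sum, hr.sum_zero, hr'.sum_zero, mul_one, hab]
  · filter_upwards [hr.sum_succ n h, hr'.sum_succ n h] with z h1 h2
    simp only [Pi.add_apply, Pi.smul_apply, smul_eq_mul, Finset.sum_add_distrib,
      ← Finset.mul_sum, h1, h2]

/-- Affine rather than linear: the coordinate of the empty history is constantly `1`. -/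
lemma planVector_combination {r r' : Decision A S → ℝ} (hr : IsPlan π p r) (hr' : IsPlan π p r')
    {a b : ℝ} (hab : a + b = 1) :
    planVector π p (a • r + b • r') = a • planVector π p r + b • planVector π p r' := by
  funext i
  obtain ⟨n, h⟩ := i
  cases n with
  | zero => simp [planVector, hab]
  | succ n =>
    simp only [planVector, Pi.add_apply, Pi.smul_apply, smul_eq_mul]
    rw [integral_add ((hr.integrable π p n _ _).const_mul a)
      ((hr'.integrable π p n _ _).const_mul b), integral_const_mul, integral_const_mul]

/-- Almost everywhere limits of realization plans are realization plans, up to a modification on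
a null set, and their vectors of realization probabilities converge. -/
lemma exists_isPlan_of_ae_tendsto {r : ℕ → Decision A S → ℝ} {g : Decision A S → ℝ}
    (hr : ∀ k, IsPlan π p (r k)) (hg : Measurable g)
    (hlim : ∀ (n : ℕ) (h : Fin n → B), ∀ᵐ z ∂obsLaw π p n h, ∀ a,
      Tendsto (fun k => r k ⟨n, z, a⟩) atTop (𝓝 (g ⟨n, z, a⟩))) :
    ∃ q, IsPlan π p q ∧
      ∀ i, Tendsto (fun k => planVector π p (r k) i) atTop (𝓝 (planVector π p q i)) := by
  -- Clamping enforces the bounds everywhere and changes nothing where the plans converge to `g`.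
  let q : Decision A S → ℝ := fun ω => max 0 (min 1 (g ω))
  have hq : Measurable q := measurable_const.max (measurable_const.min hg)
  have hqlim : ∀ (n : ℕ) (h : Fin n → B), ∀ᵐ z ∂obsLaw π p n h, ∀ a,
      Tendsto (fun k => r k ⟨n, z, a⟩) atTop (𝓝 (q ⟨n, z, a⟩)) := by
    intro n h
    filter_upwards [hlim n h] with z hz a
    have h0 : 0 ≤ g ⟨n, z, a⟩ := ge_of_tendsto' (hz a) fun k => ((hr k).mem_Icc _).1
    have h1 : g ⟨n, z, a⟩ ≤ 1 := le_of_tendsto' (hz a) fun k => ((hr k).mem_Icc _).2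
    have : q ⟨n, z, a⟩ = g ⟨n, z, a⟩ := by simp [q, h0, h1]
    rw [this]
    exact hz a
  refine ⟨q, ⟨hq, fun ω => ⟨le_max_left _ _, max_le zero_le_one (min_le_left _ _)⟩,
    fun z => ?_, fun n h => ?_⟩, fun i => ?_⟩
  · have h0 := hqlim 0 (fun i => i.elim0)
    -- There is only one private history of length `0`, so "almost everywhere" means "everywhere"
    -- here.
    rw [obsLaw, ae_dirac_iff] at h0
    · rw [Subsingleton.elim z Fin.elim0]
      refine tendsto_nhds_unique (tendsto_finsetSum _ fun a _ => h0 a) ?_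
      simp only [(hr _).sum_zero]
      exact tendsto_const_nhds
    · exact Set.Subsingleton.measurableSet Set.subsingleton_of_subsingleton
  · filter_upwards [hqlim (n + 1) h, ae_obsLaw_init π p h (hqlim n (Fin.init h)),
      ae_all_iff.2 fun k => (hr k).sum_succ n h] with z h1 h2 h3
    refine tendsto_nhds_unique (tendsto_finsetSum _ fun a _ => h1 a) ?_
    simp only [h3]
    exact h2 _
  · obtain ⟨n, h⟩ := i
    cases n with
    | zero => simp [planVector]
    | succ n =>
      simp only [planVector]
      refine tendsto_integral_of_dominated_convergence (fun _ => 1)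
        (fun k => ((hr k).integrable π p n _ _).aestronglyMeasurable) (integrable_const _)
        (fun k => ae_of_all _ fun z => ?_) ?_
      · rw [Real.norm_eq_abs, abs_of_nonneg ((hr k).mem_Icc _).1]
        exact ((hr k).mem_Icc _).2
      · filter_upwards [hqlim n (Fin.init h)] with z hz
        exact hz _

/-- A strategy with a given realization plan. -/
def planStrategy [Nonempty A] (r : Decision A S → ℝ) (hr : Measurable r) : BehavioralStrategy A S where
  act n := kernelOfWeights (fun z => normalize fun a => ENNReal.ofReal (r ⟨n, z, a⟩))
    (measurable_normalize fun a => (hr.comp (measurable_decision n a)).ennreal_ofReal)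
  isMarkov _ := isMarkovKernel_kernelOfWeights _ _ fun _ => sum_normalize
    (ENNReal.sum_ne_top.2 fun _ _ => ENNReal.ofReal_ne_top)

lemma realizationSet_nonempty [Nonempty A] : (realizationSet π p).Nonempty := by
  refine ⟨_, planStrategy (fun _ => 0) measurable_const, rfl⟩

/-- There is a finite measure on the decisions whose null sets are null for all laws of the
private history given a public history. -/
lemma exists_reference_measure [Finite B] : ∃ μ : Measure (Decision A S), IsFiniteMeasure μ ∧
    ∀ P : Decision A S → Prop, (∀ᵐ ω ∂μ, P ω) →
      ∀ (n : ℕ) (h : Fin n → B), ∀ᵐ z ∂obsLaw π p n h, ∀ a, P ⟨n, z, a⟩ := by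
  let ν : (Σ n : ℕ, (Fin n → B) × A) → Measure (Decision A S) := fun i =>
    (obsLaw π p i.1 i.2.1).map fun z => ⟨i.1, z, i.2.2⟩
  have hν : ∀ i, IsFiniteMeasure (ν i) := fun i => by
    dsimp only [ν]; infer_instance
  -- Finiteness of `A` and `B` makes the index set countable, so the sum is s-finite, and `toFinite`
  -- gives a finite measure with the same null sets.
  refine ⟨(Measure.sum ν).toFinite, inferInstance, fun P hP n h => ae_all_iff.2 fun a => ?_⟩
  have h1 : ν ⟨n, h, a⟩ ≪ (Measure.sum ν).toFinite :=
    (Measure.absolutelyContinuous_sum_right (⟨n, h, a⟩ : Σ n : ℕ, (Fin n → B) × A) Measure.AbsolutelyContinuous.rfl).trans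
      (absolutelyContinuous_toFinite _)
  exact ae_of_ae_map (measurable_decision n a).aemeasurable (h1.ae_le hP)

variable [DiscreteMeasurableSpace A]

/-- The signal after the last action affects no action counted here and integrates to `1`; this
matches the index shift in `planVector`. -/
lemma realization_succ (σ : BehavioralStrategy A S) (n : ℕ) (h : Fin (n + 1) → B) :
    realization π p σ (n + 1) h =
      ∫⁻ z, reachWeight σ n z * σ.act n z {π (h (Fin.last n))} ∂obsLaw π p n (Fin.init h) := by
  have := lintegral_reachWeight_succ π p σ h (g := fun _ => 1) measurable_const
  simpa [realization] using this

/-- The realization plan of a strategy. -/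
def strategyPlan (σ : BehavioralStrategy A S) (ω : Decision A S) : ℝ :=
  (reachWeight σ ω.1 ω.2.1 * σ.act ω.1 ω.2.1 {ω.2.2}).toReal

lemma sum_reachWeight_mul (σ : BehavioralStrategy A S) (n : ℕ) (z : Fin n → A × S) :
    ∑ a, reachWeight σ n z * σ.act n z {a} = reachWeight σ n z := by
  rw [← Finset.mul_sum, sum_measure_singleton]
  simp

lemma isPlan_strategyPlan (σ : BehavioralStrategy A S) : IsPlan π p (strategyPlan σ) := by
  have hne : ∀ (n : ℕ) (z : Fin n → A × S) (a : A), reachWeight σ n z * σ.act n z {a} ≠ ⊤ :=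
    fun n z a => ((reachWeight_mul_le_one σ n z a).trans_lt ENNReal.one_lt_top).ne
  have hsum : ∀ (n : ℕ) (z : Fin n → A × S),
      ∑ a, strategyPlan σ ⟨n, z, a⟩ = (reachWeight σ n z).toReal := fun n z => by
    simp only [strategyPlan]
    rw [← ENNReal.toReal_sum fun a _ => hne n z a, sum_reachWeight_mul]
  refine ⟨measurable_of_sigma fun n => ?_, fun ω => ⟨ENNReal.toReal_nonneg, ?_⟩, fun z => ?_,
    fun n h => ae_of_all _ fun z => ?_⟩
  · exact (((measurable_reachWeight σ n).comp measurable_fst).mul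
      (measurable_kernel_singleton (σ.act n))).ennreal_toReal
  · exact ENNReal.toReal_le_of_le_ofReal zero_le_one
      (by simpa using reachWeight_mul_le_one σ ω.1 ω.2.1 ω.2.2)
  · simp [hsum, reachWeight]
  · rw [hsum]
    rfl

lemma planVector_strategyPlan (σ : BehavioralStrategy A S) :
    planVector π p (strategyPlan σ) = realizationVector π p σ := by
  funext i
  obtain ⟨n, h⟩ := i
  cases n with
  | zero => simp [planVector, realizationVector, realization_zero]
  | succ n =>
    rw [realizationVector, realization_succ, planVector]
    simp only [strategyPlan]
    refine integral_toReal ?_ (ae_of_all _ fun z =>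
      (reachWeight_mul_le_one σ n z _).trans_lt ENNReal.one_lt_top)
    exact ((measurable_reachWeight σ n).mul
      ((σ.act n).measurable_coe MeasurableSet.of_discrete)).aemeasurable

variable [Nonempty A]

/-- The product of normalized weights telescopes: by the flow equation, the total at a history
cancels against the weight of the decision leading to it. The flow equations hold only almost
everywhere, hence so does this. -/
lemma reachWeight_planStrategy {r : Decision A S → ℝ} (hr : IsPlan π p r) (n : ℕ)
    (h : Fin n → B) : ∀ᵐ z ∂obsLaw π p n h, ∀ a,
      reachWeight (planStrategy r hr.measurable) n z *
        (planStrategy r hr.measurable).act n z {a} = ENNReal.ofReal (r ⟨n, z, a⟩) := by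
  have hact : ∀ (n : ℕ) (z : Fin n → A × S) (a : A),
      (∑ b, ENNReal.ofReal (r ⟨n, z, b⟩)) * (planStrategy r hr.measurable).act n z {a} =
        ENNReal.ofReal (r ⟨n, z, a⟩) := fun n z a => by
    rw [planStrategy, kernelOfWeights_singleton]
    exact sum_mul_normalize (ENNReal.sum_ne_top.2 fun _ _ => ENNReal.ofReal_ne_top) a
  have hsum : ∀ (n : ℕ) (z : Fin n → A × S),
      ∑ b, ENNReal.ofReal (r ⟨n, z, b⟩) = ENNReal.ofReal (∑ b, r ⟨n, z, b⟩) := fun n z =>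
    (ENNReal.ofReal_sum_of_nonneg fun b _ => (hr.mem_Icc _).1).symm
  induction n with
  | zero =>
    refine ae_of_all _ fun z a => ?_
    rw [← hact, hsum, hr.sum_zero, ENNReal.ofReal_one]
    rfl
  | succ n ih =>
    filter_upwards [ae_obsLaw_init π p h (ih (Fin.init h)), hr.sum_succ n h] with z h1 h2 a
    rw [← hact, hsum, h2, ← h1]
    rfl

lemma realizationVector_planStrategy {r : Decision A S → ℝ} (hr : IsPlan π p r) :
    realizationVector π p (planStrategy r hr.measurable) = planVector π p r := by
  funext i
  obtain ⟨n, h⟩ := i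
  cases n with
  | zero => simp [planVector, realizationVector, realization_zero]
  | succ n =>
    rw [realizationVector, realization_succ, planVector]
    simp only
    rw [integral_eq_lintegral_of_nonneg_ae (ae_of_all _ fun z => (hr.mem_Icc _).1)
      (hr.integrable π p n _ _).aestronglyMeasurable]
    congr 1
    refine lintegral_congr_ae ?_
    filter_upwards [reachWeight_planStrategy π p hr n (Fin.init h)] with z hz
    exact hz _

/-- Reach probabilities are not linear in behavioral strategies; this transfers the convex structure
of plans to them. -/
lemma realizationSet_eq_image : realizationSet π p = planVector π p '' {r | IsPlan π p r} := by
  ext v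
  constructor
  · rintro ⟨σ, rfl⟩
    exact ⟨strategyPlan σ, isPlan_strategyPlan π p σ, planVector_strategyPlan π p σ⟩
  · rintro ⟨r, hr, rfl⟩
    exact ⟨planStrategy r hr.measurable, realizationVector_planStrategy π p hr⟩

lemma convex_realizationSet : Convex ℝ (realizationSet π p) := by
  rw [realizationSet_eq_image]
  rintro _ ⟨r, hr, rfl⟩ _ ⟨r', hr', rfl⟩ a b ha hb hab
  exact ⟨a • r + b • r', convex_isPlan π p hr hr' ha hb hab,
    planVector_combination π p hr hr' hab⟩

/-- Plans approximating a closure point need not converge themselves, but those approximating it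
ever better form decreasing convex sets, from which an a.e. convergent sequence can be selected. Its
limit is a plan with the prescribed vector. -/
lemma isClosed_realizationSet [Finite B] : IsClosed (realizationSet π p) := by
  refine isClosed_of_closure_subset fun y hy => ?_
  rw [realizationSet_eq_image] at hy ⊢
  let e : (Σ n : ℕ, Fin n → B) → ℕ := (nonempty_encodable _).some.encode
  have he : Function.Injective e := (nonempty_encodable _).some.encode_injective
  -- As `k` grows, more coordinates are controlled with smaller tolerance; only finitely many at a
  -- time, so product neighborhoods of `y` suffice for nonemptiness.
  let C : ℕ → Set (Decision A S → ℝ) := fun k =>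
    {r | IsPlan π p r ∧ ∀ i, e i ≤ k → |planVector π p r i - y i| ≤ 1 / ((k : ℝ) + 1)}
  have hanti : Antitone C := fun j k hjk r hr => ⟨hr.1, fun i hi =>
    (hr.2 i (hi.trans hjk)).trans (one_div_le_one_div_of_le (by positivity) (by gcongr))⟩
  have hconv : ∀ k, Convex ℝ (C k) := by
    intro k r hr r' hr' a b ha hb hab
    refine ⟨convex_isPlan π p hr.1 hr'.1 ha hb hab, fun i hi => ?_⟩
    rw [planVector_combination π p hr.1 hr'.1 hab]
    have h := convex_closedBall (y i) (1 / ((k : ℝ) + 1))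
      (by rw [Metric.mem_closedBall, Real.dist_eq]; exact hr.2 i hi)
      (by rw [Metric.mem_closedBall, Real.dist_eq]; exact hr'.2 i hi) ha hb hab
    rwa [Metric.mem_closedBall, Real.dist_eq] at h
  have hne : ∀ k, (C k).Nonempty := by
    intro k
    have hfin : {i | e i ≤ k}.Finite := (Set.finite_Iic k).preimage he.injOn
    have hmem : Set.pi {i | e i ≤ k} (fun i => Metric.closedBall (y i) (1 / ((k : ℝ) + 1))) ∈ 𝓝 y :=
      set_pi_mem_nhds hfin fun i _ => Metric.closedBall_mem_nhds _ (by positivity)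
    obtain ⟨_, hv, r, hr, rfl⟩ := mem_closure_iff_nhds.1 hy _ hmem
    refine ⟨r, hr, fun i hi => ?_⟩
    have := hv i hi
    rwa [Metric.mem_closedBall, Real.dist_eq] at this
  obtain ⟨μ, hμ, hac⟩ := exists_reference_measure π p
  obtain ⟨r, g, hrC, hg, hlim⟩ := exists_seq_ae_tendsto_of_antitone_convex μ hanti hconv hne
    (fun f hf => hf.1.measurable) (fun f hf => hf.1.mem_Icc)
  obtain ⟨q, hq, hqlim⟩ := exists_isPlan_of_ae_tendsto π p (fun k => (hrC k).1) hg (hac _ hlim)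
  refine ⟨q, hq, funext fun i => tendsto_nhds_unique (hqlim i) ?_⟩
  refine tendsto_iff_dist_tendsto_zero.2 (squeeze_zero' (Eventually.of_forall fun _ => dist_nonneg)
    ?_ tendsto_one_div_add_atTop_nhds_zero_nat)
  filter_upwards [eventually_ge_atTop (e i)] with k hk
  exact (hrC k).2 i hk

lemma isCompact_realizationSet [Finite B] : IsCompact (realizationSet π p) := by
  refine (isCompact_univ_pi fun _ => isCompact_Icc (a := (0 : ℝ)) (b := 1)).of_isClosed_subset
    (isClosed_realizationSet π p) ?_
  rintro _ ⟨σ, rfl⟩ i -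
  exact realizationVector_mem_Icc π p σ i

end plans

/-! ### Values of the truncations and passage to the limit. -/

section value

open Filter Topology

section general

variable {A₁ A₂ S₁ S₂ : Type*}
  [MeasurableSpace A₁] [DiscreteMeasurableSpace A₁] [Finite A₁]
  [MeasurableSpace A₂] [DiscreteMeasurableSpace A₂] [Finite A₂]
  [MeasurableSpace S₁] [MeasurableSpace S₂]
  (G : PursuitEvasionGame A₁ A₂ S₁ S₂)

instance (σ₁ : BehavioralStrategy A₁ S₁) (σ₂ : BehavioralStrategy A₂ S₂) :
    IsProbabilityMeasure (G.historyMeasure σ₁ σ₂) :=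
  Measure.isProbabilityMeasure_map (by fun_prop : Measurable
    fun (z : ℕ → Stage A₁ A₂ S₁ S₂) (n : ℕ) => (z n).1).aemeasurable

lemma expectedPayoff_le_of_payoff_le {b : ℝ≥0∞} (hb : ∀ h, G.payoff h ≤ b)
    (σ₁ : BehavioralStrategy A₁ S₁) (σ₂ : BehavioralStrategy A₂ S₂) :
    G.expectedPayoff σ₁ σ₂ ≤ b :=
  (lintegral_mono hb).trans (by simp)

lemma lowerVal_le_upperVal : G.lowerVal ≤ G.upperVal :=
  iSup_le fun σ₁ => le_iInf fun σ₂ => (iInf_le _ σ₂).trans (le_iSup (G.expectedPayoff · σ₂) σ₁)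

lemma isValue_of_le {v : ℝ≥0} (h₁ : v ≤ G.lowerVal) (h₂ : G.upperVal ≤ v) : G.IsValue v :=
  ⟨le_antisymm (G.lowerVal_le_upperVal.trans h₂) h₁,
    le_antisymm h₂ (h₁.trans G.lowerVal_le_upperVal)⟩

end general

section form

variable {A₁ A₂ S₁ S₂ : Type*} [Fintype A₁] [Fintype A₂] [MeasurableSpace S₁] [MeasurableSpace S₂]
  (G : PursuitEvasionGame A₁ A₂ S₁ S₂)

/-- The expected payoff of the `n`-th truncation, as a bilinear form in the realization
probabilities of the two players. -/
def payoffForm (n : ℕ)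
    (x y : (Σ n : ℕ, Fin n → A₁ × A₂) → ℝ) : ℝ :=
  ∑ m ∈ Finset.range (n + 1), ∑ h : Fin m → A₁ × A₂, (G.f m h : ℝ) * (x ⟨m, h⟩ * y ⟨m, h⟩)

lemma continuous_payoffForm_left (n : ℕ) (y : (Σ n : ℕ, Fin n → A₁ × A₂) → ℝ) :
    Continuous fun x => G.payoffForm n x y := by
  unfold payoffForm
  fun_prop

lemma continuous_payoffForm_right (n : ℕ) (x : (Σ n : ℕ, Fin n → A₁ × A₂) → ℝ) :
    Continuous fun y => G.payoffForm n x y := by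
  unfold payoffForm
  fun_prop

lemma payoffForm_combination_left (n : ℕ) (x x' y : (Σ n : ℕ, Fin n → A₁ × A₂) → ℝ) (a b : ℝ) :
    G.payoffForm n (a • x + b • x') y = a * G.payoffForm n x y + b * G.payoffForm n x' y := by
  simp only [payoffForm, Finset.mul_sum, ← Finset.sum_add_distrib, Pi.add_apply, Pi.smul_apply,
    smul_eq_mul]
  refine Finset.sum_congr rfl fun m _ => Finset.sum_congr rfl fun h _ => ?_
  ring

lemma payoffForm_comm (n : ℕ) (x y : (Σ n : ℕ, Fin n → A₁ × A₂) → ℝ) :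
    G.payoffForm n x y = G.payoffForm n y x := by
  simp only [payoffForm, mul_comm (x _)]

end form

variable {A₁ A₂ S₁ S₂ : Type*}
  [MeasurableSpace A₁] [DiscreteMeasurableSpace A₁] [Fintype A₁]
  [MeasurableSpace A₂] [DiscreteMeasurableSpace A₂] [Fintype A₂]
  [MeasurableSpace S₁] [MeasurableSpace S₂]
  (G : PursuitEvasionGame A₁ A₂ S₁ S₂)

lemma expectedPayoff_truncate_eq_sum (n : ℕ) (σ₁ : BehavioralStrategy A₁ S₁)
    (σ₂ : BehavioralStrategy A₂ S₂) :
    (G.truncate n).expectedPayoff σ₁ σ₂ =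
      ∑ m ∈ Finset.range (n + 1), ∑ h : Fin m → A₁ × A₂, (G.f m h : ℝ≥0∞) *
        (realization Prod.fst G.p₁ σ₁ m h * realization Prod.snd G.p₂ σ₂ m h) := by
  rw [expectedPayoff_eq_tsum, tsum_eq_sum (s := Finset.range (n + 1))]
  · refine Finset.sum_congr rfl fun m hm => Finset.sum_congr rfl fun h _ => ?_
    have : m ≤ n := Nat.lt_succ_iff.1 (Finset.mem_range.1 hm)
    simp [truncate, this]
  · intro m hm
    have : ¬ m ≤ n := fun h => hm (Finset.mem_range.2 (Nat.lt_succ_iff.2 h))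
    simp [truncate, this]

lemma expectedPayoff_truncate (n : ℕ) (σ₁ : BehavioralStrategy A₁ S₁)
    (σ₂ : BehavioralStrategy A₂ S₂) :
    (G.truncate n).expectedPayoff σ₁ σ₂ = ENNReal.ofReal (G.payoffForm n
      (realizationVector Prod.fst G.p₁ σ₁) (realizationVector Prod.snd G.p₂ σ₂)) := by
  have h₁ : ∀ (m : ℕ) (h : Fin m → A₁ × A₂), realization Prod.fst G.p₁ σ₁ m h ≠ ⊤ := fun m h =>
    ((realization_le_one Prod.fst G.p₁ σ₁ m h).trans_lt ENNReal.one_lt_top).ne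
  have h₂ : ∀ (m : ℕ) (h : Fin m → A₁ × A₂), realization Prod.snd G.p₂ σ₂ m h ≠ ⊤ := fun m h =>
    ((realization_le_one Prod.snd G.p₂ σ₂ m h).trans_lt ENNReal.one_lt_top).ne
  have hterm : ∀ (m : ℕ) (h : Fin m → A₁ × A₂), (0 : ℝ) ≤ (G.f m h : ℝ) *
      (realizationVector Prod.fst G.p₁ σ₁ ⟨m, h⟩ * realizationVector Prod.snd G.p₂ σ₂ ⟨m, h⟩) :=
    fun m h => mul_nonneg (G.f m h).2 (mul_nonneg ENNReal.toReal_nonneg ENNReal.toReal_nonneg)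
  rw [expectedPayoff_truncate_eq_sum, payoffForm,
    ENNReal.ofReal_sum_of_nonneg fun m _ => Finset.sum_nonneg fun h _ => hterm m h]
  refine Finset.sum_congr rfl fun m _ => ?_
  rw [ENNReal.ofReal_sum_of_nonneg fun h _ => hterm m h]
  refine Finset.sum_congr rfl fun h _ => ?_
  rw [ENNReal.ofReal_mul (NNReal.coe_nonneg _), realizationVector, realizationVector,
    ENNReal.ofReal_mul ENNReal.toReal_nonneg, ENNReal.ofReal_coe_nnreal, ENNReal.ofReal_toReal (h₁ m h),
    ENNReal.ofReal_toReal (h₂ m h)]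

lemma expectedPayoff_truncate_mono (σ₁ : BehavioralStrategy A₁ S₁)
    (σ₂ : BehavioralStrategy A₂ S₂) : Monotone fun n => (G.truncate n).expectedPayoff σ₁ σ₂ := by
  intro m n hmn
  simp only [expectedPayoff_truncate_eq_sum]
  exact Finset.sum_le_sum_of_subset (Finset.range_mono (by omega))

lemma expectedPayoff_truncate_le (n : ℕ) (σ₁ : BehavioralStrategy A₁ S₁)
    (σ₂ : BehavioralStrategy A₂ S₂) :
    (G.truncate n).expectedPayoff σ₁ σ₂ ≤ G.expectedPayoff σ₁ σ₂ := by
  rw [expectedPayoff_truncate_eq_sum, expectedPayoff_eq_tsum]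
  exact ENNReal.sum_le_tsum _

lemma expectedPayoff_le_of_truncate_le {b : ℝ≥0∞} {σ₁ : BehavioralStrategy A₁ S₁}
    {σ₂ : BehavioralStrategy A₂ S₂} (h : ∀ n, (G.truncate n).expectedPayoff σ₁ σ₂ ≤ b) :
    G.expectedPayoff σ₁ σ₂ ≤ b := by
  rw [expectedPayoff_eq_tsum]
  refine ENNReal.tsum_le_of_sum_range_le fun n => ?_
  refine le_trans (Finset.sum_le_sum_of_subset (Finset.range_mono (Nat.le_succ n))) ?_
  rw [← expectedPayoff_truncate_eq_sum]
  exact h n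

variable [Nonempty A₂]

/-- The truncations have a value and both players have optimal strategies in them. -/
lemma exists_optimal_truncate [Nonempty A₁] (n : ℕ) :
    ∃ (v : ℝ≥0) (σ₁ : BehavioralStrategy A₁ S₁) (σ₂ : BehavioralStrategy A₂ S₂),
      (∀ τ₂, v ≤ (G.truncate n).expectedPayoff σ₁ τ₂) ∧
        ∀ τ₁, (G.truncate n).expectedPayoff τ₁ σ₂ ≤ v := by
  have hlin : ∀ (x : (Σ n : ℕ, Fin n → A₁ × A₂) → ℝ),
      IsLinearMap ℝ fun y => G.payoffForm n x y := fun x =>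
    ⟨fun y y' => by
      have := G.payoffForm_combination_left n y y' x 1 1
      simpa only [one_smul, one_mul, G.payoffForm_comm n _ x] using this,
    fun a y => by
      have := G.payoffForm_combination_left n y y x a 0
      simpa only [zero_smul, zero_mul, add_zero, G.payoffForm_comm n _ x, smul_eq_mul] using this⟩
  -- The minimizing variable comes first. Both sets are compact, so the saddle point is attained at
  -- vectors of actual strategies.
  obtain ⟨_, ⟨σ₂, rfl⟩, _, ⟨σ₁, rfl⟩, h⟩ := Sion.exists_isSaddlePointOn
    (f := fun y x => G.payoffForm n x y)
    (realizationSet_nonempty (A := A₂) Prod.snd G.p₂) (convex_realizationSet (A := A₂) Prod.snd G.p₂)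
    (isCompact_realizationSet (A := A₂) Prod.snd G.p₂)
    (fun x _ => (G.continuous_payoffForm_right n x).lowerSemicontinuous.lowerSemicontinuousOn _)
    (fun x _ => ((hlin x).mk'.convexOn (convex_realizationSet _ _)).quasiconvexOn)
    (convex_realizationSet (A := A₁) Prod.fst G.p₁)
    (realizationSet_nonempty (A := A₁) Prod.fst G.p₁)
    (isCompact_realizationSet (A := A₁) Prod.fst G.p₁)
    (fun y _ => (G.continuous_payoffForm_left n y).upperSemicontinuous.upperSemicontinuousOn _)
    (fun y _ => by
      simp only [G.payoffForm_comm n _ y]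
      exact ((hlin y).mk'.concaveOn (convex_realizationSet _ _)).quasiconcaveOn)
  refine ⟨(G.payoffForm n (realizationVector Prod.fst G.p₁ σ₁)
    (realizationVector Prod.snd G.p₂ σ₂)).toNNReal, σ₁, σ₂, fun τ₂ => ?_, fun τ₁ => ?_⟩
  · rw [expectedPayoff_truncate]
    exact ENNReal.ofReal_le_ofReal (h _ ⟨τ₂, rfl⟩ _ ⟨σ₁, rfl⟩)
  · rw [expectedPayoff_truncate]
    exact ENNReal.ofReal_le_ofReal (h _ ⟨σ₂, rfl⟩ _ ⟨τ₁, rfl⟩)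

/-- If the Minimizer can guarantee `v` in each truncation, then some strategy guarantees `v` in
all truncations. -/
lemma exists_uniform_strategy {v : ℝ≥0}
    (hv : ∀ n, ∃ σ₂, ∀ τ₁, (G.truncate n).expectedPayoff τ₁ σ₂ ≤ v) :
    ∃ σ₂, ∀ n τ₁, (G.truncate n).expectedPayoff τ₁ σ₂ ≤ v := by
  let C : ℕ → Set ((Σ n : ℕ, Fin n → A₁ × A₂) → ℝ) := fun n =>
    {y | y ∈ realizationSet (A := A₂) Prod.snd G.p₂ ∧
      ∀ m ≤ n, ∀ τ₁, G.payoffForm m (realizationVector Prod.fst G.p₁ τ₁) y ≤ v}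
  have hle : ∀ n τ₁ σ₂, (G.truncate n).expectedPayoff τ₁ σ₂ ≤ v ↔
      G.payoffForm n (realizationVector Prod.fst G.p₁ τ₁) (realizationVector Prod.snd G.p₂ σ₂) ≤ v :=
    fun n τ₁ σ₂ => by
      rw [expectedPayoff_truncate, ← ENNReal.ofReal_coe_nnreal,
        ENNReal.ofReal_le_ofReal_iff v.coe_nonneg]
  have hclosed : ∀ n, IsClosed (C n) := by
    intro n
    refine (isClosed_realizationSet (A := A₂) Prod.snd G.p₂).inter ?_
    have h : IsClosed {y | ∀ m ≤ n, ∀ τ₁,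
        G.payoffForm m (realizationVector Prod.fst G.p₁ τ₁) y ≤ v} := by
      simp only [Set.ofPred_forall]
      exact isClosed_iInter fun m => isClosed_iInter fun _ => isClosed_iInter fun τ₁ =>
        isClosed_le (G.continuous_payoffForm_right m _) continuous_const
    exact h
  obtain ⟨y, hy⟩ := IsCompact.nonempty_iInter_of_sequence_nonempty_isCompact_isClosed C
    (fun n y hy => ⟨hy.1, fun m hm => hy.2 m (hm.trans (Nat.le_succ n))⟩)
    (fun n => by
      obtain ⟨σ₂, hσ₂⟩ := hv n
      -- Nonnegative daily payoffs: a bound guaranteed in a truncation also holds in all shorter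
      -- ones.
      exact ⟨_, ⟨σ₂, rfl⟩, fun m hm τ₁ => (hle m τ₁ σ₂).1
        ((G.expectedPayoff_truncate_mono τ₁ σ₂ hm).trans (hσ₂ τ₁))⟩)
    ((isCompact_realizationSet (A := A₂) Prod.snd G.p₂).of_isClosed_subset (hclosed 0)
      fun y hy => hy.1) hclosed
  rw [Set.mem_iInter] at hy
  obtain ⟨σ₂, rfl⟩ := (hy 0).1
  exact ⟨σ₂, fun n τ₁ => (hle n τ₁ σ₂).2 ((hy n).2 n le_rfl τ₁)⟩

lemma hasUniformValue_of_isBounded [Nonempty A₁] (hG : G.IsBounded) : G.HasUniformValue := by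
  obtain ⟨b, hb⟩ := hG
  choose v σ₁ σ₂ h₁ h₂ using G.exists_optimal_truncate
  have hvb : ∀ n, v n ≤ b := fun n => ENNReal.coe_le_coe.1 <| (h₁ n (σ₂ n)).trans <|
    (G.expectedPayoff_truncate_le n _ _).trans <|
      G.expectedPayoff_le_of_payoff_le (fun h => (hb h).le) _ _
  -- The Maximizer's optimal strategy for `m` is played against the Minimizer's for `n`.
  have hmono : Monotone v := fun m n hmn => ENNReal.coe_le_coe.1 <| (h₁ m (σ₂ n)).trans <|
    (G.expectedPayoff_truncate_mono _ _ hmn).trans (h₂ n (σ₁ m))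
  have hbdd : BddAbove (Set.range v) := ⟨b, by rintro _ ⟨n, rfl⟩; exact hvb n⟩
  have hlim : Tendsto v atTop (𝓝 (⨆ n, v n)) := tendsto_atTop_ciSup hmono hbdd
  set w := ⨆ n, v n with hw
  have hvw : ∀ n, v n ≤ w := le_ciSup hbdd
  obtain ⟨σ, hσ⟩ := G.exists_uniform_strategy (v := w) fun n =>
    ⟨σ₂ n, fun τ₁ => (h₂ n τ₁).trans (ENNReal.coe_le_coe.2 (hvw n))⟩
  have hval : ∀ n, (G.truncate n).IsValue (v n) := fun n =>
    isValue_of_le _ ((le_iInf (h₁ n)).trans (le_iSup (G.truncate n).val₁ (σ₁ n)))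
      ((iInf_le (G.truncate n).val₂ (σ₂ n)).trans (iSup_le (h₂ n)))
  refine ⟨⟨w, G.isValue_of_le ?_ ?_⟩, fun ε hε => ?_⟩
  · refine le_of_tendsto' ((ENNReal.continuous_coe.tendsto w).comp hlim) fun n => ?_
    exact (le_iInf fun τ₂ => (h₁ n τ₂).trans (G.expectedPayoff_truncate_le n _ _)).trans
      (le_iSup G.val₁ (σ₁ n))
  · exact (iInf_le G.val₂ σ).trans
      (iSup_le fun τ₁ => G.expectedPayoff_le_of_truncate_le fun n => hσ n τ₁)
  · have hev : ∀ᶠ n in atTop, w < v n + ε :=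
      (hlim.add_const ε).eventually (lt_mem_nhds (lt_add_of_pos_right w hε))
    obtain ⟨N, hN⟩ := hev.exists
    have hεE : (ε : ℝ≥0∞) ≠ 0 := by simpa using hε.ne'
    -- The roles are asymmetric: `σ₁ N` depends on `ε` and secures `v N > w - ε` in longer
    -- truncations, while `σ` is independent of `ε` and concedes at most `w` in all of them.
    refine ⟨N, σ₁ N, σ, fun n hn => ⟨⟨v n, hval n, ?_, ?_⟩, ⟨v n, hval n, ?_, ?_⟩⟩⟩
    · refine (le_iSup (G.truncate n).val₁ (σ₁ N)).trans_lt ?_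
      exact (hval n).1.le.trans_lt (ENNReal.lt_add_right ENNReal.coe_ne_top hεE)
    · have h : (v N : ℝ≥0∞) ≤ (G.truncate n).val₁ (σ₁ N) := le_iInf fun τ₂ =>
        (h₁ N τ₂).trans (G.expectedPayoff_truncate_mono _ _ hn.le)
      calc (v n : ℝ≥0∞) ≤ w := ENNReal.coe_le_coe.2 (hvw n)
        _ < v N + ε := by exact_mod_cast hN
        _ ≤ _ := by gcongr
    · calc (G.truncate n).val₂ σ ≤ w := iSup_le (hσ n)
        _ < v N + ε := by exact_mod_cast hN
        _ ≤ v n + ε := by gcongr; exact hmono hn.le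
    · refine (hval n).2.ge.trans_lt ((iInf_le (G.truncate n).val₂ σ).trans_lt ?_)
      exact ENNReal.lt_add_right
        ((iSup_le (hσ n) : (G.truncate n).val₂ σ ≤ w).trans_lt ENNReal.coe_lt_top).ne hεE

end value

end PursuitEvasionGame

end

theorem theorem2 {A₁ A₂ S₁ S₂ : Type*}
    [MeasurableSpace A₁] [DiscreteMeasurableSpace A₁] [Finite A₁] [Nonempty A₁]
    [MeasurableSpace A₂] [DiscreteMeasurableSpace A₂] [Finite A₂] [Nonempty A₂]
    [MeasurableSpace S₁] [MeasurableSpace S₂]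
    (G : PursuitEvasionGame A₁ A₂ S₁ S₂) (hG : G.IsBounded) :
    G.HasUniformValue := by
  have := Fintype.ofFinite A₁
  have := Fintype.ofFinite A₂
  exact G.hasUniformValue_of_isBounded hG
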